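/- Let $X$ be a countable Hausdorff topological group whose underlying space is sequential (every sequentially closed subset is closed). Identify each subset of $X$ with its characteristic function, so that the topology of $X$ becomes a subset of $2^X$, where $2^X$ carries the product topology. Then the following are equivalent: (1) the topology of $X$ is analytic, i.e. it is a continuous image of $\mathbb{N}^{\mathbb{N}}$ as a subset of $2^X$; (2) the topology of $X$ is an $F_{\sigma\delta}$ subset of $2^X$, i.e. a countable intersection of countable unions of closed sets; (3) $X$ is first countable or $X$ is a $k_\omega$-space, where $X$ is called a $k_\omega$-space if there are compact sets $K_n\subseteq X$, $n\in\mathbb{N}$, such that a set $U\subseteq X$ is open if and only if $U\cap K_n$ is relatively open in $K_n$ for every $n$. -/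

import Mathlib

/-- The topology of `X`, viewed as a subset of the Cantor cube `2^X`: a set `U ⊆ X` is identified
with its characteristic function, and `X → Bool` carries the product of the discrete topologies. -/
def topologyAsSubset (X : Type*) [TopologicalSpace X] : Set (X → Bool) :=
  {f | IsOpen {x : X | f x = true}}

/-- The topology of `X` is analytic: as a subset of `2^X` it is a continuous image of `ℕ → ℕ`
(the exception for the empty set in Mathlib's notion is void here, since `∅` and `X` are open). -/
def HasAnalyticTopology (X : Type*) [TopologicalSpace X] : Prop :=
  MeasureTheory.AnalyticSet (topologyAsSubset X)

/-- A set is `F_σδ` if it is a countable intersection of countable unions of closed sets. -/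
def IsFSigmaDelta {Y : Type*} [TopologicalSpace Y] (s : Set Y) : Prop :=
  ∃ F : ℕ → ℕ → Set Y, (∀ n m, IsClosed (F n m)) ∧ s = ⋂ n, ⋃ m, F n m

/-- The topology of `X` is `F_σδ` as a subset of `2^X`. -/
def HasFSigmaDeltaTopology (X : Type*) [TopologicalSpace X] : Prop :=
  IsFSigmaDelta (topologyAsSubset X)

/-- `X` is a `k_ω`-space: there are compact sets `K n`, `n ∈ ℕ`, such that a set `U ⊆ X` is open
if and only if every `U ∩ K n` is relatively open in `K n`. -/
def IsKOmegaSpace (X : Type*) [TopologicalSpace X] : Prop :=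
  ∃ K : ℕ → Set X, (∀ n, IsCompact (K n)) ∧
    ∀ U : Set X, IsOpen U ↔ ∀ n, IsOpen ((Subtype.val : K n → X) ⁻¹' U)

/-! For (3) ⇒ (2), openness is tested at countably many points of countably many pieces with
countably generated relative neighbourhood filters. For (1) ⇒ (3), a Baire argument on codes of open
neighbourhoods of `1` gives `CountableDichotomyAt`, applied to three classes when `X` is not first
countable. Nowhere dense sets yield a fan: sequences tending to `1` with no convergent diagonal. The
complements `N k` of its tails absorb all convergent sequences, so translation-bounded sets have no
bad `π`-network and some such `A n` absorb the sequences tending to `1`. For compactly caught sets,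
the first alternative gives `k_ω`. In the second, sequences `d n` in the network sets, without
convergent subsequences, are multiplied by fan rows `t n`; the products form a closed set missing
`1`, yet every neighbourhood of `1` contains one. -/

open Filter Topology Set

/-! ### The dichotomy for analytic topologies -/

/-- For every class `I` of subsets, either countably many members of `I` catch infinitely many
terms of each sequence converging to `x`, or countably many sets outside `I` form a `π`-network
at `x`. -/
def CountableDichotomyAt {X : Type*} [TopologicalSpace X] (x : X) : Prop :=
  ∀ I : Set (Set X),
    (∃ K : ℕ → Set X, (∀ i, K i ∈ I) ∧
      ∀ s : ℕ → X, Tendsto s atTop (𝓝 x) → ∃ i, ∃ᶠ j in atTop, s j ∈ K i) ∨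
    (∃ H : ℕ → Set X, (∀ i, H i ∉ I) ∧ ∀ U ∈ 𝓝 x, ∃ i, H i ⊆ U)

/-- A continuous parametrization of a neighbourhood base by a Polish space yields the
dichotomy. -/
theorem countableDichotomyAt_of_continuous {X P : Type*} [TopologicalSpace X]
    [TopologicalSpace P] [PolishSpace P] {x : X} (φ : P → X → Bool) (hφ : Continuous φ)
    (hmem : ∀ p, {z | φ p z = true} ∈ 𝓝 x)
    (hbasis : ∀ U ∈ 𝓝 x, ∃ p, {z | φ p z = true} ⊆ U) : CountableDichotomyAt x := by
  intro I
  let Small : Set P → Prop := fun Q =>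
    ∃ H : Set (Set X), H.Countable ∧ (∀ h ∈ H, h ∉ I) ∧ ∀ p ∈ Q, ∃ h ∈ H, h ⊆ {z | φ p z = true}
  by_cases huniv : Small univ
  · right
    obtain ⟨H, hHc, hHI, hH⟩ := huniv
    have hne : H.Nonempty := by
      obtain ⟨p, -⟩ := hbasis univ univ_mem
      obtain ⟨h, hh, -⟩ := hH p (mem_univ p)
      exact ⟨h, hh⟩
    obtain ⟨f, rfl⟩ := hHc.exists_eq_range hne
    refine ⟨f, fun i => hHI _ ⟨i, rfl⟩, fun U hU => ?_⟩
    obtain ⟨p, hp⟩ := hbasis U hU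
    obtain ⟨_, ⟨i, rfl⟩, hi⟩ := hH p (mem_univ p)
    exact ⟨i, hi.trans hp⟩
  left
  have hmono : ∀ Q Q' : Set P, Q ⊆ Q' → Small Q' → Small Q := by
    rintro Q Q' h ⟨H, h1, h2, h3⟩
    exact ⟨H, h1, h2, fun p hp => h3 p (h hp)⟩
  have hsUnion : ∀ 𝒬 : Set (Set P), 𝒬.Countable → (∀ Q ∈ 𝒬, Small Q) → Small (⋃₀ 𝒬) := by
    intro 𝒬 h𝒬 h
    choose! H h1 h2 h3 using h
    refine ⟨⋃ Q ∈ 𝒬, H Q, h𝒬.biUnion h1, ?_, ?_⟩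
    · intro h hh
      simp only [mem_iUnion] at hh
      obtain ⟨Q, hQ, hh⟩ := hh
      exact h2 Q hQ h hh
    · rintro p ⟨Q, hQ, hp⟩
      obtain ⟨h, hh, hs⟩ := h3 Q hQ p hp
      exact ⟨h, mem_biUnion hQ hh, hs⟩
  have hunion : ∀ Q Q' : Set P, Small Q → Small Q' → Small (Q ∪ Q') := by
    intro Q Q' h h'
    rw [← sUnion_pair]
    exact hsUnion _ ((countable_singleton _).insert _) (by simp [h, h'])
  let b := TopologicalSpace.countableBasis P
  have hb : TopologicalSpace.IsTopologicalBasis b := TopologicalSpace.isBasis_countableBasis P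
  have hbc : b.Countable := TopologicalSpace.countable_countableBasis P
  set S : Set P := ⋃₀ {O ∈ b | Small O} with hS
  have hSsmall : Small S := hsUnion _ (hbc.mono fun _ h => h.1) fun _ h => h.2
  have hSopen : IsOpen S := isOpen_sUnion fun O hO => hb.isOpen hO.1
  -- With all small basic open sets removed, no nonempty relatively open part of `R` is small.
  set R : Set P := Sᶜ with hR
  have hRclosed : IsClosed R := hSopen.isClosed_compl
  have hRne : R.Nonempty := by
    by_contra h
    rw [not_nonempty_iff_eq_empty, hR, compl_empty_iff] at h
    exact huniv (h ▸ hSsmall)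
  have hbig : ∀ O ∈ b, (O ∩ R).Nonempty → ¬ Small (O ∩ R) := by
    rintro O hO ⟨p, hpO, hpR⟩ hsm
    refine hpR ⟨O, ⟨hO, hmono _ ((O ∩ R) ∪ S) ?_ (hunion _ _ hsm hSsmall)⟩, hpO⟩
    intro q hq
    by_cases hqS : q ∈ S
    · exact Or.inr hqS
    · exact Or.inl ⟨hq, hqS⟩
  let V : Set P → Set X := fun O => {z | ∀ p ∈ O ∩ R, φ p z = true}
  have hV : ∀ O ∈ b, (O ∩ R).Nonempty → V O ∈ I := by
    intro O hO hne
    by_contra h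
    refine hbig O hO hne ⟨{V O}, countable_singleton _, by simpa using h, fun p hp => ?_⟩
    exact ⟨V O, rfl, fun z hz => hz p hp⟩
  let 𝒦 : Set (Set X) := V '' {O ∈ b | (O ∩ R).Nonempty}
  have h𝒦c : 𝒦.Countable := (hbc.mono fun _ h => h.1).image _
  have h𝒦ne : 𝒦.Nonempty := by
    obtain ⟨p, hp⟩ := hRne
    obtain ⟨O, hO, hpO, -⟩ := hb.exists_subset_of_mem_open (mem_univ p) isOpen_univ
    exact ⟨_, O, ⟨hO, p, hpO, hp⟩, rfl⟩
  obtain ⟨K, hK⟩ := h𝒦c.exists_eq_range h𝒦ne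
  refine ⟨K, fun i => ?_, fun s hs => ?_⟩
  · obtain ⟨O, hO, h⟩ : K i ∈ 𝒦 := hK ▸ mem_range_self i
    exact h ▸ hV O hO.1 hO.2
  by_contra hcon
  have hcon' : ∀ O ∈ b, (O ∩ R).Nonempty → ∀ᶠ j in atTop, s j ∉ V O := by
    intro O hO hne
    have : V O ∈ range K := hK ▸ ⟨O, ⟨hO, hne⟩, rfl⟩
    obtain ⟨i, hi⟩ := this
    rw [← hi, ← not_frequently]
    exact fun h => hcon ⟨i, h⟩
  have := hRclosed.polishSpace
  have := hRne.to_subtype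
  -- If `s` eventually avoids every `V O`, each `G n` is dense; a code in all of them is a
  -- neighbourhood of `x` missing `s` infinitely often.
  let G : ℕ → Set R := fun n => ⋃ j ≥ n, {p : R | φ p (s j) = false}
  have hGo : ∀ n, IsOpen (G n) := fun n => isOpen_biUnion fun j _ =>
    (isOpen_discrete ({false} : Set Bool)).preimage
      (((continuous_apply (s j)).comp hφ).comp continuous_subtype_val)
  have hGd : ∀ n, Dense (G n) := by
    intro n
    rw [dense_iff_inter_open]
    rintro W hW ⟨p, hp⟩
    obtain ⟨W', hW', rfl⟩ := isOpen_induced_iff.1 hW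
    obtain ⟨O, hO, hpO, hOW⟩ := hb.exists_subset_of_mem_open hp hW'
    obtain ⟨j, hj, hjn⟩ := ((hcon' O hO ⟨p, hpO, p.2⟩).and (eventually_ge_atTop n)).exists
    simp only [V, mem_ofPred_eq, not_forall] at hj
    obtain ⟨q, hq, hqf⟩ := hj
    refine ⟨⟨q, hq.2⟩, hOW hq.1, ?_⟩
    simp only [G, mem_iUnion]
    exact ⟨j, hjn, by simpa using hqf⟩
  obtain ⟨p, hp⟩ := (dense_iInter_of_isOpen_nat hGo hGd).nonempty
  obtain ⟨n, hn⟩ := eventually_atTop.1 (hs.eventually (hmem p))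
  have hpn := mem_iInter.1 hp n
  simp only [G, mem_iUnion] at hpn
  obtain ⟨j, hj, hjf⟩ := hpn
  have h1 : φ p (s j) = true := hn j hj
  have h2 : φ p (s j) = false := hjf
  rw [h1] at h2
  exact absurd h2 (by decide)

theorem HasAnalyticTopology.countableDichotomyAt {X : Type*} [TopologicalSpace X]
    (h : HasAnalyticTopology X) (x : X) : CountableDichotomyAt x := by
  rw [HasAnalyticTopology, MeasureTheory.AnalyticSet] at h
  obtain h | ⟨f, hf, hr⟩ := h
  · exact absurd (show (fun _ => true) ∈ topologyAsSubset X by simp [topologyAsSubset])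
      (by simp [h])
  have hclosed : IsClosed {p | f p x = true} :=
    (isClosed_discrete ({true} : Set Bool)).preimage ((continuous_apply x).comp hf)
  have := hclosed.polishSpace
  have hopen : ∀ p, IsOpen {z | f p z = true} := fun p => by
    have : f p ∈ topologyAsSubset X := hr ▸ mem_range_self p
    exact this
  refine countableDichotomyAt_of_continuous (P := {p | f p x = true}) (fun p => f p)
    (hf.comp continuous_subtype_val) (fun p => (hopen p).mem_nhds p.2) fun U hU => ?_
  classical
  obtain ⟨O, hOU, hO, hxO⟩ := mem_nhds_iff.1 hU
  have : (fun z => decide (z ∈ O)) ∈ topologyAsSubset X := by simpa [topologyAsSubset] using hO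
  rw [← hr] at this
  obtain ⟨p, hp⟩ := this
  refine ⟨⟨p, by simp [hp, hxO]⟩, fun z hz => hOU ?_⟩
  simpa [hp] using hz

/-! ### Descriptive complexity of the topology -/

theorem IsFSigmaDelta.analyticSet {Y : Type*} [TopologicalSpace Y] [PolishSpace Y] {s : Set Y}
    (h : IsFSigmaDelta s) : MeasureTheory.AnalyticSet s := by
  obtain ⟨F, hF, rfl⟩ := h
  exact .iInter fun n => .iUnion fun m => (hF n m).analyticSet

theorem HasFSigmaDeltaTopology.hasAnalyticTopology {X : Type*} [TopologicalSpace X] [Countable X]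
    (h : HasFSigmaDeltaTopology X) : HasAnalyticTopology X := by
  have : PolishSpace Bool := inferInstance
  exact IsFSigmaDelta.analyticSet h

/-- For fixed `i`, `x` and `m`, the condition "if `x ∈ U` then the `m`-th basic neighbourhood lies
in `U`" is closed in `2^X`. -/
theorem hasFSigmaDeltaTopology_of_determined {X : Type*} [TopologicalSpace X] [Countable X]
    [Nonempty X] (K : ℕ → Set X) (hK : ∀ i, ∀ x ∈ K i, (𝓝[K i] x).IsCountablyGenerated)
    (hd : ∀ U : Set X, IsOpen U ↔ ∀ i, ∀ x ∈ K i, x ∈ U → U ∈ 𝓝[K i] x) :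
    HasFSigmaDeltaTopology X := by
  have hbase : ∀ i x, ∃ B : ℕ → Set X, x ∈ K i → (𝓝[K i] x).HasAntitoneBasis B := by
    intro i x
    by_cases hx : x ∈ K i
    · have := hK i x hx
      obtain ⟨B, hB⟩ := (𝓝[K i] x).exists_antitone_basis
      exact ⟨B, fun _ => hB⟩
    · exact ⟨fun _ => ∅, fun h => absurd h hx⟩
  choose B hB using hbase
  obtain ⟨e, he⟩ := exists_surjective_nat (ℕ × X)
  refine ⟨fun n m => {f | (e n).2 ∈ K (e n).1 → f (e n).2 = true →
    ∀ z ∈ B (e n).1 (e n).2 m, f z = true}, fun n m => ?_, ?_⟩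
  · have hcl : ∀ (z : X) (c : Bool), IsClosed {f : X → Bool | f z = c} := fun z c =>
      isClosed_eq (continuous_apply z) continuous_const
    simp only [ofPred_forall]
    refine isClosed_iInter fun _ => ?_
    have := (hcl (e n).2 false).union
      (isClosed_biInter fun z (_ : z ∈ B (e n).1 (e n).2 m) => hcl z true)
    convert this using 1
    ext f
    simp [imp_iff_not_or]
  · ext f
    simp only [mem_iInter, mem_iUnion, mem_ofPred_eq, topologyAsSubset, hd]
    constructor
    · intro h n
      by_cases hn : (e n).2 ∈ K (e n).1 ∧ f (e n).2 = true
      · obtain ⟨m, hm⟩ := (hB _ _ hn.1).mem_iff.1 (h _ _ hn.1 hn.2)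
        exact ⟨m, fun _ _ z hz => hm hz⟩
      · exact ⟨0, fun h1 h2 => absurd ⟨h1, h2⟩ hn⟩
    · intro h i x hx hfx
      obtain ⟨n, hn⟩ := he (i, x)
      obtain ⟨m, hm⟩ := h n
      rw [hn] at hm
      exact (hB i x hx).mem_iff.2 ⟨m, fun z hz => hm hx hfx z hz⟩

/-- Countably many closed neighbourhoods of `x` intersect in `{x}`; by compactness their traces on
`K` generate the filter. -/
theorem IsCompact.isCountablyGenerated_nhdsWithin {X : Type*} [TopologicalSpace X] [T2Space X]
    [Countable X] {K : Set X} (hK : IsCompact K) (x : X) :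
    (𝓝[K] x).IsCountablyGenerated := by
  have hsep : ∀ y : X, ∃ C : Set X, C ∈ 𝓝 x ∧ IsClosed C ∧ (y ≠ x → y ∉ C) := by
    intro y
    by_cases hy : y = x
    · exact ⟨univ, univ_mem, isClosed_univ, fun h => absurd hy h⟩
    · obtain ⟨u, v, hu, hv, hxu, hyv, huv⟩ := t2_separation (Ne.symm hy)
      exact ⟨vᶜ, mem_of_superset (hu.mem_nhds hxu) huv.subset_compl_right, hv.isClosed_compl,
        fun _ h => h hyv⟩
  choose C hC hCc hCy using hsep
  have : 𝓝[K] x = (⨅ y, 𝓟 (C y)) ⊓ 𝓟 K := by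
    refine le_antisymm (inf_le_inf_right _ (le_iInf fun y => le_principal_iff.2 (hC y))) ?_
    intro U hU
    obtain ⟨O, hO, hxO, hOU⟩ := mem_nhdsWithin.1 hU
    obtain ⟨F, hF⟩ := (hK.diff hO).elim_finite_subfamily_closed C hCc (by
      rw [eq_empty_iff_forall_notMem]
      rintro z ⟨⟨-, hzO⟩, hz⟩
      exact hCy z (fun h => hzO (h ▸ hxO)) (mem_iInter.1 hz z))
    refine mem_inf_of_inter (s := ⋂ y ∈ F, C y) (t := K) ?_ (mem_principal_self K) ?_
    · exact (biInter_finset_mem F).2 fun y _ => mem_iInf_of_mem y (mem_principal_self _)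
    · rintro z ⟨hz, hzK⟩
      by_contra hzU
      have : z ∈ K \ O ∩ ⋂ y ∈ F, C y := ⟨⟨hzK, fun hzO => hzU (hOU ⟨hzO, hzK⟩)⟩, hz⟩
      rw [hF] at this
      exact this
  rw [this]
  infer_instance

theorem FirstCountableTopology.hasFSigmaDeltaTopology {X : Type*} [TopologicalSpace X]
    [Countable X] [Nonempty X] [FirstCountableTopology X] : HasFSigmaDeltaTopology X := by
  refine hasFSigmaDeltaTopology_of_determined (fun _ => univ) (fun _ x _ => ?_) fun U => ?_
  · rw [nhdsWithin_univ]
    infer_instance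
  · simp [isOpen_iff_mem_nhds]

theorem IsKOmegaSpace.hasFSigmaDeltaTopology {X : Type*} [TopologicalSpace X] [T2Space X]
    [Countable X] [Nonempty X] (h : IsKOmegaSpace X) : HasFSigmaDeltaTopology X := by
  obtain ⟨K, hK, hU⟩ := h
  refine hasFSigmaDeltaTopology_of_determined K
    (fun i x _ => (hK i).isCountablyGenerated_nhdsWithin x) fun U => ?_
  rw [hU]
  refine forall_congr' fun i => ?_
  simp only [isOpen_iff_mem_nhds, Subtype.forall, mem_preimage]
  exact forall₃_congr fun x hx _ => preimage_coe_mem_nhds_subtype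

/-! ### Sequential compactness and absorption -/

/-- A set all of whose sequences have a subsequence converging in the ambient space. -/
def IsRelSeqCompact {X : Type*} [TopologicalSpace X] (A : Set X) : Prop :=
  ∀ s : ℕ → X, (∀ n, s n ∈ A) → ∃ x, ∃ φ : ℕ → ℕ, StrictMono φ ∧ Tendsto (s ∘ φ) atTop (𝓝 x)

/-- Every sequence converging to `x` is eventually in some `A i`. -/
def AbsorbsSeq {X : Type*} [TopologicalSpace X] (A : ℕ → Set X) (x : X) : Prop :=
  ∀ s : ℕ → X, Tendsto s atTop (𝓝 x) → ∃ i, ∀ᶠ j in atTop, s j ∈ A i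

section Topology

variable {X : Type*} [TopologicalSpace X]

/-- Points of `A` chosen outside ever more sets of a countable cover cannot have a convergent
subsequence. Regularity lets the finite cover pass from `A` to its closure. -/
theorem IsRelSeqCompact.isCompact_closure [RegularSpace X] [Countable X] {A : Set X}
    (hA : IsRelSeqCompact A) : IsCompact (closure A) := by
  classical
  refine isCompact_of_finite_subcover fun {ι} U hU hcov => ?_
  rcases isEmpty_or_nonempty X with hX | hX
  · exact ⟨∅, fun x => isEmptyElim x⟩
  have hG : ∀ x : X, ∃ G : Set X, ∃ F : Finset ι, IsOpen G ∧ (x ∈ closure A → x ∈ G) ∧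
      closure G ⊆ ⋃ i ∈ F, U i := by
    intro x
    by_cases hx : x ∈ closure A
    · obtain ⟨i, hi⟩ := mem_iUnion.1 (hcov hx)
      obtain ⟨C, hC, hCc, hCU⟩ := exists_mem_nhds_isClosed_subset ((hU i).mem_nhds hi)
      refine ⟨interior C, {i}, isOpen_interior, fun _ => mem_interior_iff_mem_nhds.2 hC, ?_⟩
      simpa using (closure_minimal interior_subset hCc).trans hCU
    · exact ⟨∅, ∅, isOpen_empty, fun h => absurd h hx, by simp⟩
  choose G F hGo hxG hGF using hG
  obtain ⟨e, he⟩ := exists_surjective_nat X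
  obtain ⟨n, hn⟩ : ∃ n, A ⊆ ⋃ l ∈ Finset.range n, closure (G (e l)) := by
    by_contra! hcon
    have : ∀ n, ∃ a ∈ A, ∀ l < n, a ∉ closure (G (e l)) := by
      intro n
      obtain ⟨a, ha, hn⟩ := not_subset.1 (hcon n)
      refine ⟨a, ha, fun l hl h => hn ?_⟩
      exact mem_biUnion (Finset.mem_coe.2 (Finset.mem_range.2 hl)) h
    choose a haA ha using this
    obtain ⟨x, φ, hφ, hx⟩ := hA a haA
    obtain ⟨l, rfl⟩ := he x
    have hxA : e l ∈ closure A :=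
      mem_closure_of_tendsto hx (Eventually.of_forall fun n => haA _)
    obtain ⟨n, hn, hln⟩ := ((hx.eventually ((hGo (e l)).mem_nhds (hxG _ hxA))).and
      (eventually_gt_atTop l)).exists
    exact ha (φ n) l (hln.trans_le (hφ.id_le n)) (subset_closure hn)
  refine ⟨(Finset.range n).biUnion fun l => F (e l), ?_⟩
  have hc : closure A ⊆ ⋃ l ∈ Finset.range n, closure (G (e l)) :=
    closure_minimal hn (isClosed_biUnion_finset fun _ _ => isClosed_closure)
  intro x hx
  obtain ⟨l, hl, hxl⟩ := mem_iUnion₂.1 (hc hx)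
  obtain ⟨i, hi, hxi⟩ := mem_iUnion₂.1 (hGF _ hxl)
  exact mem_iUnion₂.2 ⟨i, Finset.mem_biUnion.2 ⟨l, hl, hi⟩, hxi⟩

theorem absorbs_of_frequently {A : ℕ → Set X} (hA : Monotone A) {x : X}
    (h : ∀ s : ℕ → X, Tendsto s atTop (𝓝 x) → ∃ i, ∃ᶠ j in atTop, s j ∈ A i) : AbsorbsSeq A x := by
  intro s hs
  by_contra! hcon
  obtain ⟨φ, hφ, hsφ⟩ := extraction_forall_of_frequently (P := fun i j => s j ∉ A i) fun i =>
    by simpa using hcon i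
  obtain ⟨i, hi⟩ := h (s ∘ φ) (hs.comp hφ.tendsto_atTop)
  obtain ⟨j, hj, hij⟩ := (hi.and_eventually (eventually_ge_atTop i)).exists
  exact hsφ j (hA hij hj)

/-- For an ideal, the first alternative of the dichotomy yields an increasing sequence of members
that absorbs all sequences converging to the point. -/
theorem CountableDichotomyAt.exists_absorbs {x : X} (h : CountableDichotomyAt x)
    {I : Set (Set X)} (hI : ∀ A ∈ I, ∀ B ∈ I, A ∪ B ∈ I)
    (hnet : ∀ H : ℕ → Set X, (∀ i, H i ∉ I) → ¬ ∀ U ∈ 𝓝 x, ∃ i, H i ⊆ U) :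
    ∃ A : ℕ → Set X, Monotone A ∧ (∀ i, A i ∈ I) ∧ AbsorbsSeq A x := by
  obtain ⟨K, hKI, hK⟩ | ⟨H, hHI, hH⟩ := h I
  · refine ⟨partialSups K, (partialSups K).monotone, fun i => ?_, ?_⟩
    · induction i with
      | zero => simpa using hKI 0
      | succ i ih =>
        rw [partialSups_add_one]
        exact hI _ ih _ (hKI _)
    · refine absorbs_of_frequently (partialSups K).monotone fun s hs => ?_
      obtain ⟨i, hi⟩ := hK s hs
      exact ⟨i, hi.mono fun j hj => le_partialSups K i hj⟩
  · exact absurd hH (hnet H hHI)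

theorem isClosed_of_finite_inter [T1Space X] [SequentialSpace X] {N : ℕ → Set X}
    (hN : ∀ x, AbsorbsSeq N x) {Z : Set X} (hZ : ∀ k, (Z ∩ N k).Finite) : IsClosed Z := by
  refine IsSeqClosed.isClosed fun s x hs hx => ?_
  obtain ⟨k, hk⟩ := hN x s hx
  exact ((hZ k).isClosed.mem_of_tendsto hx (hk.mono fun j hj => ⟨hs j, hj⟩)).1

/-- A convergent sequence meeting every tail of the fan would contain a convergent diagonal. -/
theorem absorbs_compl_fan {T : ℕ → ℕ → X}
    (hT : ∀ j m : ℕ → ℕ, StrictMono j → ∀ x, ¬ Tendsto (fun i => T (j i) (m i)) atTop (𝓝 x))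
    (x : X) : AbsorbsSeq (fun k => {z | ∀ j ≥ k, ∀ m, T j m ≠ z}) x := by
  intro s hs
  by_contra! hcon
  obtain ⟨φ, hφ, hsφ⟩ := extraction_forall_of_frequently
    (P := fun k i => ∃ j ≥ k, ∃ m, T j m = s i) fun k =>
      (not_eventually.1 (hcon k)).mono fun i hi => by simpa using hi
  choose j hj m hm using hsφ
  obtain ⟨ψ, hψ, hjψ⟩ := strictMono_subseq_of_tendsto_atTop
    (tendsto_atTop_mono hj tendsto_id)
  refine hT (j ∘ ψ) (m ∘ ψ) hjψ x ?_
  simp only [Function.comp_apply, hm]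
  exact hs.comp (hφ.comp hψ).tendsto_atTop

end Topology

/-! ### First countability and the sequential fan -/

section Group

variable {X : Type*} [Group X] [TopologicalSpace X] [IsTopologicalGroup X]

theorem firstCountableTopology_of_nhds_one (h : (𝓝 (1 : X)).IsCountablyGenerated) :
    FirstCountableTopology X := by
  refine ⟨fun x => ?_⟩
  rw [← map_mul_left_nhds_one x]
  infer_instance

theorem exists_nhds_one_inv_mul_subset {W : Set X} (hW : W ∈ 𝓝 (1 : X)) :
    ∃ V ∈ 𝓝 (1 : X), ∀ a ∈ V, ∀ b ∈ V, a⁻¹ * b ∈ W := by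
  have h : Tendsto (fun p : X × X => p.1⁻¹ * p.2) (𝓝 1 ×ˢ 𝓝 1) (𝓝 1) := by
    rw [← nhds_prod_eq]
    have : Continuous fun p : X × X => p.1⁻¹ * p.2 := by fun_prop
    simpa using this.tendsto (1, 1)
  obtain ⟨V, hV, hVW⟩ := mem_prod_same_iff.1 (h hW)
  exact ⟨V, hV, fun a ha b hb => hVW (mk_mem_prod ha hb)⟩

/-- Translating the interior of `closure (H i)` to `1` by one of its points gives a neighbourhood
base, since `V⁻¹ * V` is small for small `V`. -/
theorem firstCountableTopology_of_piNetwork {H : ℕ → Set X}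
    (hH : ∀ i, ¬ IsNowhereDense (H i)) (hnet : ∀ U ∈ 𝓝 (1 : X), ∃ i, H i ⊆ U) :
    FirstCountableTopology X := by
  apply firstCountableTopology_of_nhds_one
  set O : ℕ → Set X := fun i => interior (closure (H i))
  have hO : ∀ i, (O i).Nonempty := fun i => nonempty_iff_ne_empty.2 (hH i)
  choose a ha using hO
  let B : ℕ → Set X := fun i => (fun z => a i * z) ⁻¹' O i
  have hB : ∀ i, B i ∈ 𝓝 (1 : X) := fun i =>
    (isOpen_interior.preimage (continuous_const_mul (a i))).mem_nhds (by simpa [B] using ha i)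
  have : (𝓝 (1 : X)).HasBasis (fun _ : ℕ => True) B := by
    refine ⟨fun W => ⟨fun hW => ?_, fun ⟨i, _, hi⟩ => mem_of_superset (hB i) hi⟩⟩
    obtain ⟨V, hV, hVW⟩ := exists_nhds_one_inv_mul_subset hW
    obtain ⟨C, hC, hCc, hCV⟩ := exists_mem_nhds_isClosed_subset hV
    obtain ⟨i, hi⟩ := hnet C hC
    have hOV : O i ⊆ V := (interior_subset.trans (closure_minimal hi hCc)).trans hCV
    refine ⟨i, trivial, fun z hz => ?_⟩
    simpa using hVW _ (hOV (ha i)) _ (hOV hz)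
  exact this.isCountablyGenerated

/-- The property that any sequence of sequences converging to `1` admits a sequence converging
to `1` and meeting infinitely many of them forces first countability. -/
theorem firstCountableTopology_of_diagonal [SequentialSpace X]
    (hd : CountableDichotomyAt (1 : X))
    (hα : ∀ T : ℕ → ℕ → X, (∀ j, Tendsto (T j) atTop (𝓝 1)) →
      ∃ j m : ℕ → ℕ, StrictMono j ∧ Tendsto (fun i => T (j i) (m i)) atTop (𝓝 1)) :
    FirstCountableTopology X := by
  -- The diagonal property, translated to the points `y n`, makes the sequential closure
  -- sequentially closed.
  have hF : ∀ A : Set X, closure A ⊆ seqClosure A := by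
    intro A
    refine closure_minimal subset_seqClosure (IsSeqClosed.isClosed fun y x hy hx => ?_)
    choose T hTA hT using hy
    obtain ⟨j, m, hj, hjm⟩ := hα (fun n i => (y n)⁻¹ * T n i) fun n => by
      simpa using (hT n).const_mul (y n)⁻¹
    refine ⟨fun i => T (j i) (m i), fun i => hTA _ _, ?_⟩
    simpa using (hx.comp hj.tendsto_atTop).mul hjm
  by_contra hfc
  obtain ⟨N, hNm, hNI, hN⟩ := hd.exists_absorbs (I := {A | IsNowhereDense A})
    (fun A hA B hB => by
      change interior (closure (A ∪ B)) = ∅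
      rw [closure_union, interior_union_isClosed_of_interior_empty isClosed_closure hB]
      exact hA)
    fun H hH hnet => hfc (firstCountableTopology_of_piNetwork hH hnet)
  have hT : ∀ n, ∃ t : ℕ → X, (∀ i, t i ∉ N n) ∧ Tendsto t atTop (𝓝 1) := by
    intro n
    have hn : interior (N n) = ∅ :=
      subset_empty_iff.1 ((interior_mono subset_closure).trans (hNI n).subset)
    have : (1 : X) ∈ closure (N n)ᶜ := by rw [closure_compl, hn]; simp
    exact hF _ this
  choose T hTN hT using hT
  obtain ⟨j, m, hj, hjm⟩ := hα T hT
  obtain ⟨k, hk⟩ := hN _ hjm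
  obtain ⟨i, hi, hki⟩ := (hk.and (eventually_ge_atTop k)).exists
  exact hTN (j i) (m i) (hNm (hki.trans (hj.id_le i)) hi)

/-- Without first countability there is a closed copy of the sequential fan at `1`. -/
theorem exists_fan [T2Space X] [Countable X] [SequentialSpace X]
    (hd : CountableDichotomyAt (1 : X)) (hfc : ¬ FirstCountableTopology X) :
    ∃ T : ℕ → ℕ → X, (∀ j, Tendsto (T j) atTop (𝓝 1)) ∧
      ∀ j m : ℕ → ℕ, StrictMono j → ∀ x, ¬ Tendsto (fun i => T (j i) (m i)) atTop (𝓝 x) := by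
  obtain ⟨T, hT, hTd⟩ : ∃ T : ℕ → ℕ → X, (∀ j, Tendsto (T j) atTop (𝓝 1)) ∧
      ∀ j m : ℕ → ℕ, StrictMono j → ¬ Tendsto (fun i => T (j i) (m i)) atTop (𝓝 1) := by
    by_contra! hcon
    exact hfc (firstCountableTopology_of_diagonal hd hcon)
  obtain ⟨e, he⟩ := exists_surjective_nat X
  have hO : ∀ x : X, ∃ C ∈ 𝓝 (1 : X), x ≠ 1 → Cᶜ ∈ 𝓝 x := by
    intro x
    by_cases hx : x = 1
    · exact ⟨univ, univ_mem, fun h => absurd hx h⟩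
    · obtain ⟨u, v, hu, hv, hxu, h1v, huv⟩ := t2_separation hx
      exact ⟨v, hv.mem_nhds h1v, fun _ => mem_of_superset (hu.mem_nhds hxu)
        huv.subset_compl_right⟩
  choose C hC hCx using hO
  -- Truncating row `j` near `1`, away from `e 0, …, e j` where these differ from `1`, rules out
  -- diagonal limits other than `1`.
  have hg : ∀ j, ∃ g, ∀ m ≥ g, ∀ l ≤ j, T j m ∈ C (e l) := fun j =>
    eventually_atTop.1 ((eventually_all_finite (finite_le_nat j)).2 fun l _ =>
      (hT j).eventually (hC (e l)))
  choose g hg using hg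
  refine ⟨fun j m => T j (m + g j), fun j => (tendsto_add_atTop_iff_nat (g j)).2 (hT j),
    fun j m hj x hx => ?_⟩
  by_cases hx1 : x = 1
  · subst hx1
    exact hTd j (fun i => m i + g (j i)) hj hx
  · obtain ⟨l, rfl⟩ := he x
    obtain ⟨i, hi, hli⟩ := ((hx.eventually (hCx _ hx1)).and (eventually_ge_atTop l)).exists
    exact hi (hg (j i) _ (Nat.le_add_left _ _) l (hli.trans (hj.id_le i)))

/-- The countably many translates of the `A i` absorb the sequences converging to any point. -/
theorem isKOmegaSpace_of_absorbs [T2Space X] [Countable X] [SequentialSpace X] {A : ℕ → Set X}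
    (hA : ∀ i, IsCompact (A i)) (h : AbsorbsSeq A 1) : IsKOmegaSpace X := by
  obtain ⟨e, he⟩ := exists_surjective_nat (X × ℕ)
  refine ⟨fun n => (fun z => (e n).1 * z) '' A (e n).2,
    fun n => (hA _).image (continuous_const_mul _),
    fun U => ⟨fun hU n => hU.preimage continuous_subtype_val, fun hU => ?_⟩⟩
  rw [← isClosed_compl_iff]
  refine IsSeqClosed.isClosed fun s x hs hx hxU => ?_
  obtain ⟨i, hi⟩ := h (fun n => x⁻¹ * s n) (by simpa using hx.const_mul x⁻¹)
  obtain ⟨n, hn⟩ := he (x, i)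
  set K : Set X := (fun z => (e n).1 * z) '' A (e n).2 with hK
  have hsK : ∀ᶠ j in atTop, s j ∈ K := hi.mono fun j hj => by
    rw [hK, hn]
    exact ⟨_, hj, by simp⟩
  have hxK : x ∈ K := ((hA _).image (continuous_const_mul _)).isClosed.mem_of_tendsto hx hsK
  obtain ⟨O, hO, hOU⟩ := isOpen_induced_iff.1 (hU n)
  have hiff : ∀ z ∈ K, z ∈ O ↔ z ∈ U := fun z hz =>
    Set.ext_iff.1 hOU ⟨z, hz⟩
  obtain ⟨j, hjK, hjO⟩ := (hsK.and
    (hx.eventually (hO.mem_nhds ((hiff x hxK).2 hxU)))).exists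
  exact hs j ((hiff _ hjK).1 hjO)

end Group

/-! ### Non-first-countable groups are `k_ω` -/

/-- Left translates of `A` by the inverses of the terms of any sequence converging to `1`
are eventually contained in a single member of `N`. -/
def IsTranslationBounded {X : Type*} [Group X] [TopologicalSpace X] (N : ℕ → Set X)
    (A : Set X) : Prop :=
  ∀ s : ℕ → X, Tendsto s atTop (𝓝 1) → ∃ k, ∀ᶠ j in atTop, ∀ a ∈ A, (s j)⁻¹ * a ∈ N k

/-- The sequences in `A` converging to `x` are caught by countably many relatively sequentially
compact sets. -/
def IsCompactlyCaught {X : Type*} [TopologicalSpace X] (x : X) (A : Set X) : Prop :=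
  ∃ K : ℕ → Set X, (∀ i, IsRelSeqCompact (K i)) ∧
    ∀ s : ℕ → X, Tendsto s atTop (𝓝 x) → (∀ n, s n ∈ A) → ∃ i, ∃ᶠ j in atTop, s j ∈ K i

theorem tendsto_atTop_of_not_frequently_eq {n : ℕ → ℕ}
    (h : ¬ ∃ l, ∃ᶠ i in atTop, n i = l) : Tendsto n atTop atTop := by
  refine tendsto_atTop.2 fun k => ?_
  have : ∀ᶠ i in atTop, ∀ l < k, n i ≠ l :=
    (eventually_all_finite (finite_lt_nat k)).2 fun l _ => not_frequently.1 fun hl => h ⟨l, hl⟩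
  exact this.mono fun i hi => not_lt.1 fun hik => hi _ hik rfl

section Topology

variable {X : Type*} [TopologicalSpace X] {x : X}

theorem IsRelSeqCompact.isCompactlyCaught {A : Set X} (hA : IsRelSeqCompact A) :
    IsCompactlyCaught x A :=
  ⟨fun _ => A, fun _ => hA, fun _ _ hs => ⟨0, (Eventually.of_forall hs).frequently⟩⟩

/-- A set is compactly caught if the sequences in it are caught by countably many compactly
caught sets. -/
theorem isCompactlyCaught_of_countable {A : Set X} {B : ℕ → Set X}
    (hB : ∀ i, IsCompactlyCaught x (B i))
    (h : ∀ s : ℕ → X, Tendsto s atTop (𝓝 x) → (∀ n, s n ∈ A) → ∃ i, ∃ᶠ j in atTop, s j ∈ B i) :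
    IsCompactlyCaught x A := by
  choose K hK hKB using hB
  refine ⟨fun n => K n.unpair.1 n.unpair.2, fun n => hK _ _, fun s hs hsA => ?_⟩
  obtain ⟨i, hi⟩ := h s hs hsA
  obtain ⟨φ, hφ, hsφ⟩ := extraction_of_frequently_atTop hi
  obtain ⟨l, hl⟩ := hKB i (s ∘ φ) (hs.comp hφ.tendsto_atTop) hsφ
  exact ⟨Nat.pair i l, by simpa using hφ.tendsto_atTop.frequently hl⟩

end Topology

section Group

variable {X : Type*} [Group X] [TopologicalSpace X] [IsTopologicalGroup X]

theorem isKOmegaSpace_of_isCompactlyCaught [T2Space X] [Countable X] [SequentialSpace X]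
    (h : IsCompactlyCaught (1 : X) univ) : IsKOmegaSpace X := by
  obtain ⟨K, hK, hs⟩ := h
  refine isKOmegaSpace_of_absorbs (A := partialSups fun i => closure (K i)) (fun i => ?_)
    (absorbs_of_frequently (partialSups _).monotone fun s hs1 => ?_)
  · induction i with
    | zero => simpa using (hK 0).isCompact_closure
    | succ i ih =>
      rw [partialSups_add_one]
      exact ih.union (hK _).isCompact_closure
  · obtain ⟨i, hi⟩ := hs s hs1 fun _ => mem_univ _
    exact ⟨i, hi.mono fun j hj => le_partialSups (fun i => closure (K i)) i (subset_closure hj)⟩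

/-- Failure for `H i` yields products `(t i k)⁻¹ * a i k ∉ N k`. Those with `k ≥ i, k₀` form a
closed set missing `1`, which a `π`-network would be forced to hit. -/
theorem not_piNetwork_of_not_isTranslationBounded [T1Space X] [SequentialSpace X]
    {N : ℕ → Set X} (hNm : Monotone N) (hN : ∀ x, AbsorbsSeq N x) {H : ℕ → Set X}
    (hH : ∀ i, ¬ IsTranslationBounded N (H i)) : ¬ ∀ U ∈ 𝓝 (1 : X), ∃ i, H i ⊆ U := by
  intro hnet
  have hz : ∀ i, ∃ t a : ℕ → X, Tendsto t atTop (𝓝 1) ∧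
      ∀ k, a k ∈ H i ∧ (t k)⁻¹ * a k ∉ N k := by
    intro i
    have := hH i
    simp only [IsTranslationBounded, not_forall, not_exists] at this
    obtain ⟨s, hs, hk⟩ := this
    obtain ⟨φ, hφ, hsφ⟩ := extraction_forall_of_frequently
      (P := fun k j => ∃ a ∈ H i, (s j)⁻¹ * a ∉ N k) fun k =>
        (not_eventually.1 (hk k)).mono fun j hj => by simpa using hj
    choose a haH ha using hsφ
    exact ⟨s ∘ φ, a, hs.comp hφ.tendsto_atTop, fun k => ⟨haH k, ha k⟩⟩
  choose t a ht ha using hz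
  obtain ⟨k₀, hk₀⟩ := hN 1 (fun _ => 1) tendsto_const_nhds
  have hk₀ : (1 : X) ∈ N k₀ := hk₀.exists.choose_spec
  let z : ℕ → ℕ → X := fun i k => (t i k)⁻¹ * a i k
  let Z : Set X := {y | ∃ i k, i ≤ k ∧ k₀ ≤ k ∧ z i k = y}
  have hZc : IsClosed Z := by
    refine isClosed_of_finite_inter hN fun n => ?_
    refine (((finite_lt_nat n).prod (finite_lt_nat n)).image fun p : ℕ × ℕ => z p.1 p.2).subset ?_
    rintro y ⟨⟨i, k, hik, -, rfl⟩, hy⟩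
    have hkn : k < n := not_le.1 fun hnk => (ha i k).2 (hNm hnk hy)
    exact ⟨(i, k), ⟨hik.trans_lt hkn, hkn⟩, rfl⟩
  have h1 : (1 : X) ∉ Z := by
    rintro ⟨i, k, -, hk, h⟩
    exact (ha i k).2 (hNm hk (by change z i k ∈ _; rwa [h]))
  obtain ⟨V, hV, hVZ⟩ := exists_nhds_one_inv_mul_subset (hZc.isOpen_compl.mem_nhds h1)
  obtain ⟨i, hi⟩ := hnet V hV
  obtain ⟨k, hkV, hk⟩ := (((ht i).eventually hV).and (eventually_ge_atTop (max i k₀))).exists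
  exact hVZ _ hkV _ (hi (ha i k).1)
    ⟨i, k, (le_max_left _ _).trans hk, (le_max_right _ _).trans hk, rfl⟩

theorem exists_nhds_one_mul_disjoint [T2Space X] (x : X) :
    ∃ P ∈ 𝓝 (1 : X), x ≠ 1 → ∀ᶠ y in 𝓝 x, ∀ a ∈ P, ∀ b ∈ P, a * b ≠ y := by
  by_cases hx : x = 1
  · exact ⟨univ, univ_mem, fun h => absurd hx h⟩
  obtain ⟨u, v, hu, hv, hxu, h1v, huv⟩ := t2_separation hx
  obtain ⟨P, hP, h1P, hPv⟩ := exists_open_nhds_one_mul_subset (hv.mem_nhds h1v)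
  refine ⟨P, hP.mem_nhds h1P, fun _ => mem_of_superset (hu.mem_nhds hxu) ?_⟩
  rintro y hy a ha b hb rfl
  exact disjoint_left.1 huv hy (hPv (mul_mem_mul ha hb))

/-- A double sequence of products `d n m * t n m`, with `d n` without convergent subsequences and
`t n` converging to `1`, that shrinks to `1` along the rows and leaves an absorbing sequence of
sets, has closed range. -/
theorem isClosed_range_mul [T2Space X] [SequentialSpace X] {A : ℕ → Set X} (hAm : Monotone A)
    (hA : AbsorbsSeq A 1) {d t : ℕ → ℕ → X} (ht : ∀ n, Tendsto (t n) atTop (𝓝 1))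
    (hd : ∀ n x (φ : ℕ → ℕ), StrictMono φ → ¬ Tendsto (d n ∘ φ) atTop (𝓝 x))
    (hdA : ∀ n m, d n m * t n m ∉ A n)
    (hne : ∀ x ≠ 1, ∃ k, ∀ᶠ y in 𝓝 x, ∀ n ≥ k, ∀ m, d n m * t n m ≠ y) :
    IsClosed {y | ∃ n m, d n m * t n m = y} := by
  refine IsSeqClosed.isClosed fun s x hs hx => ?_
  choose n m hnm using hs
  -- A recurring row forces a recurring column, as `d l` has no convergent subsequence; rows tending
  -- to infinity are excluded by `hA` at `1` and by `hne` elsewhere.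
  by_cases hn : ∃ l, ∃ᶠ i in atTop, n i = l
  · obtain ⟨l, hl⟩ := hn
    obtain ⟨φ, hφ, hnφ⟩ := extraction_of_frequently_atTop hl
    have hxφ := hx.comp hφ.tendsto_atTop
    by_cases hm : ∃ r, ∃ᶠ i in atTop, m (φ i) = r
    · obtain ⟨r, hr⟩ := hm
      refine ⟨l, r, ?_⟩
      by_contra hne'
      obtain ⟨i, hi, hi'⟩ := (hr.and_eventually
        (hxφ.eventually (isOpen_ne.mem_nhds (Ne.symm hne')))).exists
      apply hi'
      rw [Function.comp_apply, ← hnm, hnφ, hi]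
    · have hm' := tendsto_atTop_of_not_frequently_eq hm
      obtain ⟨ψ, hψ, hmψ⟩ := strictMono_subseq_of_tendsto_atTop hm'
      refine absurd ?_ (hd l x _ hmψ)
      have h := (hxφ.comp hψ.tendsto_atTop).mul ((ht l).comp hmψ.tendsto_atTop).inv
      simp only [inv_one, mul_one] at h
      refine h.congr fun i => ?_
      simp only [Function.comp_apply]
      rw [← hnm, hnφ, mul_inv_cancel_right]
  · have hn' := tendsto_atTop_of_not_frequently_eq hn
    exfalso
    by_cases hx1 : x = 1
    · obtain ⟨k, hk⟩ := hA s (hx1 ▸ hx)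
      obtain ⟨i, hi, hki⟩ := (hk.and (hn'.eventually_ge_atTop k)).exists
      exact hdA (n i) (m i) (hAm hki (by rwa [hnm]))
    · obtain ⟨k, hk⟩ := hne x hx1
      obtain ⟨i, hi, hki⟩ := ((hx.eventually hk).and (hn'.eventually_ge_atTop k)).exists
      exact hi _ hki _ (hnm i)

theorem isKOmegaSpace_of_not_firstCountableTopology [T2Space X] [Countable X]
    [SequentialSpace X] (hdich : CountableDichotomyAt (1 : X))
    (hfc : ¬ FirstCountableTopology X) : IsKOmegaSpace X := by
  obtain ⟨T, hT, hTd⟩ := exists_fan hdich hfc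
  set N : ℕ → Set X := fun k => {z | ∀ j ≥ k, ∀ m, T j m ≠ z} with hNdef
  have hNm : Monotone N := fun k l hkl z hz j hj => hz j (hkl.trans hj)
  have hN : ∀ x, AbsorbsSeq N x := absorbs_compl_fan hTd
  obtain ⟨A', hAm', hAN', hA'⟩ := hdich.exists_absorbs (I := {A | IsTranslationBounded N A})
    (fun B hB C hC s hs => by
      obtain ⟨k, hk⟩ := hB s hs
      obtain ⟨l, hl⟩ := hC s hs
      refine ⟨max k l, (hk.and hl).mono fun j hj a ha => ?_⟩
      exact ha.elim (fun ha => hNm (le_max_left k l) (hj.1 a ha))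
        fun ha => hNm (le_max_right k l) (hj.2 a ha))
    fun H hH => not_piNetwork_of_not_isTranslationBounded hNm hN hH
  by_contra hkω
  obtain ⟨K, hKI, hK⟩ | ⟨H, hHI, hH⟩ := hdich {A | IsCompactlyCaught 1 A}
  · exact hkω (isKOmegaSpace_of_isCompactlyCaught
      (isCompactlyCaught_of_countable hKI fun s hs _ => hK s hs))
  obtain ⟨A, hAm, hAN, hA, h1A⟩ : ∃ A : ℕ → Set X, Monotone A ∧
      (∀ i, IsTranslationBounded N (A i)) ∧ AbsorbsSeq A 1 ∧ ∀ i, (1 : X) ∈ A i := by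
    obtain ⟨k, hk⟩ := hA' (fun _ => 1) tendsto_const_nhds
    have hk : (1 : X) ∈ A' k := hk.exists.choose_spec
    refine ⟨fun i => A' (i + k), fun i j hij => hAm' (by lia), fun i => hAN' _, fun s hs => ?_,
      fun i => hAm' (by lia) hk⟩
    obtain ⟨i, hi⟩ := hA' s hs
    exact ⟨i, hi.mono fun j hj => hAm' (by lia) hj⟩
  choose P hP hPx using exists_nhds_one_mul_disjoint (X := X)
  obtain ⟨e, he⟩ := exists_surjective_nat X
  let W : ℕ → Set X := fun n => ⋂ l ∈ {l | l ≤ n}, P (e l)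
  have hW : ∀ n, W n ∈ 𝓝 (1 : X) := fun n => (biInter_mem (finite_le_nat n)).2 fun l _ => hP _
  -- Otherwise, for each `k`, the points of `H n ∩ W n` translating `A n` into `N k` form a
  -- relatively sequentially compact set, so `H n` is compactly caught.
  have hd : ∀ n, ∃ k, ∃ d : ℕ → X, (∀ m, d m ∈ H n ∧ d m ∈ W n ∧ ∀ a ∈ A n, (d m)⁻¹ * a ∈ N k) ∧
      ∀ x (φ : ℕ → ℕ), StrictMono φ → ¬ Tendsto (d ∘ φ) atTop (𝓝 x) := by
    intro n
    by_contra! hcon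
    refine hHI n (isCompactlyCaught_of_countable
      (B := fun k => {y | y ∈ H n ∧ y ∈ W n ∧ ∀ a ∈ A n, y⁻¹ * a ∈ N k})
      (fun k => IsRelSeqCompact.isCompactlyCaught fun s hs => hcon k s hs) fun s hs hsH => ?_)
    obtain ⟨k, hk⟩ := hAN n s hs
    exact ⟨k, ((hk.and (hs.eventually (hW n))).mono fun j hj => ⟨hsH j, hj.2, hj.1⟩).frequently⟩
  choose f d hd hdx using hd
  have hg : ∀ n, ∃ g, ∀ m ≥ g, T (f n) m ∈ W n := fun n =>
    eventually_atTop.1 ((hT (f n)).eventually (hW n))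
  choose g hg using hg
  let t : ℕ → ℕ → X := fun n m => T (f n) (m + g n)
  have ht : ∀ n, Tendsto (t n) atTop (𝓝 1) := fun n => (tendsto_add_atTop_iff_nat (g n)).2 (hT _)
  -- `N (f n)` omits row `f n` of the fan, whence `t n m` is taken.
  have hdA : ∀ n m, d n m * t n m ∉ A n := fun n m h => by
    have := (hd n m).2.2 _ h
    rw [inv_mul_cancel_left] at this
    exact this (f n) le_rfl (m + g n) rfl
  have hZ := isClosed_range_mul hAm hA ht hdx hdA fun x hx => by
    obtain ⟨l, rfl⟩ := he x
    refine ⟨l, (hPx _ hx).mono fun y hy n hn m => ?_⟩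
    have hWP : W n ⊆ P (e l) := biInter_subset_of_mem hn
    exact hy _ (hWP (hd n m).2.1) _ (hWP (hg n _ (Nat.le_add_left _ _)))
  obtain ⟨V, hVo, h1V, hVZ⟩ := exists_open_nhds_one_mul_subset (hZ.isOpen_compl.mem_nhds
    (show (1 : X) ∉ _ from fun ⟨n, m, h⟩ => hdA n m (h ▸ h1A n)))
  obtain ⟨n, hn⟩ := hH V (hVo.mem_nhds h1V)
  obtain ⟨m, hm⟩ := ((ht n).eventually (hVo.mem_nhds h1V)).exists
  exact hVZ (mul_mem_mul (hn (hd n m).1) hm) ⟨n, m, rfl⟩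

end Group

theorem mainTheorem1 (X : Type*) [Group X] [TopologicalSpace X] [IsTopologicalGroup X]
    [T2Space X] [Countable X] [SequentialSpace X] :
    List.TFAE [HasAnalyticTopology X,
      HasFSigmaDeltaTopology X,
      FirstCountableTopology X ∨ IsKOmegaSpace X] := by
  tfae_have 1 → 3 := fun h => or_iff_not_imp_left.2
    (isKOmegaSpace_of_not_firstCountableTopology (h.countableDichotomyAt 1))
  tfae_have 3 → 2 := by
    rintro (h | h)
    · exact h.hasFSigmaDeltaTopology
    · exact h.hasFSigmaDeltaTopology
  tfae_have 2 → 1 := fun h => h.hasAnalyticTopology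
  tfae_finish
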